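/- A complete deterministic automaton $\mathcal A=(Q,\Sigma,\delta)$ consists of a finite set $Q$ of states, a finite alphabet $\Sigma$ and a (total) transition function $\delta:Q\times\Sigma\to Q$, which extends to an action of the words $w\in\Sigma^*$ on $Q$. The rank of a word $w$ is the cardinality of $Q\cdot w=\{q\cdot w: q\in Q\}$. The automaton is synchronizing if the smallest rank of a word is $1$, and its reset threshold $\operatorname{rt}(\mathcal A)$ is then the length of a shortest word of rank $1$. There is a function $f:\mathbb N\to\mathbb R$ with $f(n)=o(n^3)$ as $n\to\infty$ such that every synchronizing complete deterministic automaton $\mathcal A$ with $n$ states (over any finite alphabet) satisfies $$\operatorname{rt}(\mathcal A)\le\left(\frac{7}{48}+\frac{2\cdot 15625}{1597536}\right)n^3+f(n).$$ In particular, there is an absolute constant $C$ such that $\operatorname{rt}(\mathcal A)\le 0.1654\,n^3+C$ for every such automaton $\mathcal A$ with $n$ states. -/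

import Mathlib

open Filter Asymptotics

universe u v

/-- A complete deterministic automaton (without initial and final states) with alphabet `α` and
set of states `Q`: every letter acts on `Q` by a total map. -/
structure CompleteAutomaton (α : Type*) (Q : Type*) where
  /-- The transition function. -/
  step : Q → α → Q

namespace CompleteAutomaton

variable {α Q : Type*} (A : CompleteAutomaton α Q)

/-- The action of the free monoid of words on states: letters are applied from left to right. -/
def act (q : Q) (w : List α) : Q := w.foldl A.step q

/-- The set `S · w` of images of the elements of `S` under the word `w`. -/
def image (S : Set Q) (w : List α) : Set Q := (fun q => A.act q w) '' S

/-- The rank of a word `w`: the cardinality of `Q · w`. -/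
noncomputable def wordRank (w : List α) : ℕ := (A.image Set.univ w).ncard

/-- The rank of the automaton: the smallest rank of a word. -/
noncomputable def rank : ℕ := sInf (Set.range A.wordRank)

/-- An automaton is synchronizing if its rank is one. -/
def IsSynchronizing : Prop := A.rank = 1

/-- The reset threshold: the smallest length of a word of rank one. (Such words exist when the
automaton is synchronizing; only then is the value meaningful.) -/
noncomputable def resetThreshold : ℕ := sInf {m | ∃ w : List α, A.wordRank w = 1 ∧ w.length = m}

end CompleteAutomaton

/-! Restricting to the states reachable from the target of a reset word costs at most `n²` letters
and makes every state the target of some constant word. The rank is then lowered one unit at a time.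
At rank `n - e` the Frankl–Pin bound allows a step of length `tri e ≈ e²/2`, and used throughout it
gives `n³/6`. The gain comes from the steps with `e < n/2`.

Let `ε l` be the number of states avoided by some word of length at most `l`, and let `a` be the
first length at which all states are avoidable, capped at about `n²/8`. Slow and fast growth of `ε`
both help. While some state is unavoidable, an image is compressed by a word of length about `ε l +
1` (`exists_short_compressing_word`), so a word of length at most `a` already has deficit `k` at
least about `∑ 1/(ε l + 1)` over `l < a` (`exists_word_of_rank_deficit`). Once `ε l > 2e`, a prefix
of length at most `l` lowers the rank from `n - e` (`exists_rank_reducing_prefix`). Hence for `e <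
n/2` the step costs `f e`, the minimum of `tri e` and `countLE ε a e`.

It remains to maximise `∑ f e` over `k ≤ e < h`, `h ≈ n/2`. Summing by layers turns the lower bound
on `k` into the linear constraint `a/(2h+1) + ∑ f e / (2(e+1)²) ≤ k + error` (`sum_countLE_le`).
With `a ≈ s²/2` one also has `f e ≤ min(e², s²)/2` up to `O(n)`. The extremal profile vanishes below
`y = 2s/5` and meets this cap above it; `sum_le_of_large` and `sum_le_of_small` prove the resulting
bound for `k` on either side of `y`. Maximising over `s` (`cubic_le`) gives `15625/798768`, and the
steps with `e ≥ n/2` give `7/48`. All errors are `O(n² √n)`. -/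

theorem linearIndependent_of_triangular {m : ℕ} {V : Type*} [AddCommGroup V] [Module ℝ V]
    (v : Fin m → V) (φ : Fin m → V →ₗ[ℝ] ℝ) (h0 : ∀ i j, i < j → φ j (v i) = 0)
    (h1 : ∀ i, φ i (v i) ≠ 0) : LinearIndependent ℝ v := by
  rw [Fintype.linearIndependent_iff]
  intro g hg i
  induction i using WellFoundedGT.induction with
  | ind i ih =>
    have h := congrArg (φ i) hg
    rw [map_sum, map_zero, Finset.sum_eq_single i] at h
    · rw [map_smul, smul_eq_mul] at h
      exact (mul_eq_zero.mp h).resolve_right (h1 i)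
    · intro j _ hji
      rcases lt_or_gt_of_ne hji with hlt | hgt
      · rw [map_smul, h0 j i hlt, smul_zero]
      · rw [ih j hgt, zero_smul, map_zero]
    · simp

/-- The triangular number `(k + 1) (k + 2) / 2`. -/
def tri (k : ℕ) : ℕ := (k + 1) * (k + 2) / 2

theorem two_mul_tri (k : ℕ) : 2 * tri k = (k + 1) * (k + 2) :=
  Nat.mul_div_cancel' (Nat.even_mul_succ_self (k + 1)).two_dvd

/-! ### Skew set-pair inequality by the polynomial method -/

section SkewBollobas

variable {Q : Type*} (t : Q → ℝ)

/-- The functions on pairs of points given by monomials of total degree at most `k` in the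
elementary symmetric polynomials of two variables. -/
noncomputable def symmMonomials (k : ℕ) : Finset (Q × Q → ℝ) := by
  classical
  exact ((Finset.range (k + 1)).biUnion fun d => Finset.HasAntidiagonal.antidiagonal d).image
    fun p z => (t z.1 + t z.2) ^ p.1 * (t z.1 * t z.2) ^ p.2

theorem mem_symmMonomials {k : ℕ} {f : Q × Q → ℝ} :
    f ∈ symmMonomials t k ↔
      ∃ i j, i + j ≤ k ∧ f = fun z => (t z.1 + t z.2) ^ i * (t z.1 * t z.2) ^ j := by
  classical
  simp only [symmMonomials, Finset.mem_image, Finset.mem_biUnion, Finset.mem_range,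
    Finset.HasAntidiagonal.mem_antidiagonal, Prod.exists]
  constructor
  · rintro ⟨i, j, ⟨d, hd, rfl⟩, rfl⟩
    exact ⟨i, j, by omega, rfl⟩
  · rintro ⟨i, j, h, rfl⟩
    exact ⟨i, j, ⟨i + j, by omega, rfl⟩, rfl⟩

theorem card_symmMonomials_le (k : ℕ) : (symmMonomials t k).card ≤ tri k := by
  classical
  refine Finset.card_image_le.trans (Finset.card_biUnion_le.trans ?_)
  have h : ∀ k : ℕ, 2 * ∑ d ∈ Finset.range (k + 1), (Finset.HasAntidiagonal.antidiagonal d).card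
      = (k + 1) * (k + 2) := by
    intro k
    induction k with
    | zero => simp
    | succ k ih =>
      rw [Finset.sum_range_succ, mul_add, ih, Finset.Nat.card_antidiagonal]
      ring
  have := h k
  have := two_mul_tri k
  omega

theorem span_symmMonomials_mono {k l : ℕ} (h : k ≤ l) :
    Submodule.span ℝ (symmMonomials t k : Set (Q × Q → ℝ)) ≤
      Submodule.span ℝ (symmMonomials t l : Set (Q × Q → ℝ)) := by
  refine Submodule.span_mono fun f hf => ?_
  rw [Finset.mem_coe, mem_symmMonomials] at hf ⊢
  obtain ⟨i, j, hij, rfl⟩ := hf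
  exact ⟨i, j, hij.trans h, rfl⟩

/-- Since `(c - x)(c - y) = c² - c(x + y) + xy`, such a factor raises the degree in `x + y` and `xy`
by at most one. -/
theorem mul_mem_span_symmMonomials (c : ℝ) {k : ℕ} {f : Q × Q → ℝ}
    (hf : f ∈ Submodule.span ℝ (symmMonomials t k : Set (Q × Q → ℝ))) :
    (fun z => (c - t z.1) * (c - t z.2) * f z) ∈
      Submodule.span ℝ (symmMonomials t (k + 1) : Set (Q × Q → ℝ)) := by
  induction hf using Submodule.span_induction with
  | mem f hf =>
    rw [Finset.mem_coe, mem_symmMonomials] at hf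
    obtain ⟨i, j, hij, rfl⟩ := hf
    have hmem : ∀ i' j', i' + j' ≤ k + 1 →
        (fun z : Q × Q => (t z.1 + t z.2) ^ i' * (t z.1 * t z.2) ^ j') ∈
          Submodule.span ℝ (symmMonomials t (k + 1) : Set (Q × Q → ℝ)) := fun i' j' h =>
      Submodule.subset_span (Finset.mem_coe.mpr ((mem_symmMonomials t).mpr ⟨i', j', h, rfl⟩))
    convert Submodule.add_mem _ (Submodule.add_mem _
      (Submodule.smul_mem _ (c ^ 2) (hmem i j (by omega)))
      (Submodule.smul_mem _ (-c) (hmem (i + 1) j (by omega))))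
      (hmem i (j + 1) (by omega)) using 1
    funext z
    simp only [Pi.add_apply, Pi.smul_apply, smul_eq_mul]
    ring
  | zero =>
    convert Submodule.zero_mem _ using 1
    funext z
    simp
  | add f g _ _ hf hg =>
    convert Submodule.add_mem _ hf hg using 1
    funext z
    simp only [Pi.add_apply]
    ring
  | smul r f _ hf =>
    convert Submodule.smul_mem _ r hf using 1
    funext z
    simp only [Pi.smul_apply, smul_eq_mul]
    ring

theorem prod_mem_span_symmMonomials (C : Finset Q) :
    (fun z : Q × Q => ∏ c ∈ C, (t c - t z.1) * (t c - t z.2)) ∈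
      Submodule.span ℝ (symmMonomials t C.card : Set (Q × Q → ℝ)) := by
  classical
  induction C using Finset.induction_on with
  | empty =>
    refine Submodule.subset_span (Finset.mem_coe.mpr ((mem_symmMonomials t).mpr ⟨0, 0, le_rfl, ?_⟩))
    simp
  | insert c C hc ih =>
    simp only [Finset.prod_insert hc, Finset.card_insert_of_notMem hc]
    exact mul_mem_span_symmMonomials t (t c) ih

/-- The skew version of Bollobás's theorem on set pairs, for sets of size at most two. -/
theorem skew_bollobas_pairs [Finite Q] {m k : ℕ} (C : Fin m → Finset Q) (x y : Fin m → Q)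
    (hC : ∀ i, (C i).card ≤ k) (hx : ∀ i, x i ∉ C i) (hy : ∀ i, y i ∉ C i)
    (hskew : ∀ i j, i < j → x j ∈ C i ∨ y j ∈ C i) : m ≤ tri k := by
  obtain ⟨N, ⟨e⟩⟩ := Finite.exists_equiv_fin Q
  -- Distinct real labels for the states; `F i` then vanishes at a pair exactly when the pair meets
  -- `C i`.
  let t : Q → ℝ := fun q => ((e q : ℕ) : ℝ)
  have ht : Function.Injective t := fun a b h => e.injective (Fin.ext (Nat.cast_injective h))
  let W := Submodule.span ℝ (symmMonomials t k : Set (Q × Q → ℝ))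
  let F : Fin m → Q × Q → ℝ := fun i z => ∏ c ∈ C i, (t c - t z.1) * (t c - t z.2)
  have hF : ∀ i, F i ∈ W := fun i =>
    span_symmMonomials_mono t (hC i) (prod_mem_span_symmMonomials t (C i))
  have hlin : LinearIndependent ℝ F := by
    refine linearIndependent_of_triangular F (fun j => LinearMap.proj (x j, y j)) ?_ ?_
    · intro i j hij
      simp only [F, LinearMap.proj_apply]
      rcases hskew i j hij with h | h
      · exact Finset.prod_eq_zero h (by simp)
      · exact Finset.prod_eq_zero h (by simp)
    · intro i
      simp only [F, LinearMap.proj_apply]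
      refine Finset.prod_ne_zero_iff.mpr fun c hc => mul_ne_zero ?_ ?_
      · exact sub_ne_zero.mpr fun h => hx i (ht h ▸ hc)
      · exact sub_ne_zero.mpr fun h => hy i (ht h ▸ hc)
  have hlin' : LinearIndependent ℝ (fun i => (⟨F i, hF i⟩ : W)) :=
    LinearIndependent.of_comp W.subtype (by simpa [Function.comp_def] using hlin)
  have h1 := hlin'.fintype_card_le_finrank
  rw [Fintype.card_fin] at h1
  exact h1.trans ((finrank_span_finset_le_card _).trans (card_symmMonomials_le t k))

end SkewBollobas

namespace CompleteAutomaton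

/-! ### Words acting on finite sets of states -/

section Basics

variable {α Q : Type*} (A : CompleteAutomaton α Q)

theorem act_append (q : Q) (u v : List α) : A.act q (u ++ v) = A.act (A.act q u) v :=
  List.foldl_append

theorem act_take_drop (q : Q) (i : ℕ) (u : List α) :
    A.act (A.act q (u.take i)) (u.drop i) = A.act q u := by
  rw [← act_append, List.take_append_drop]

variable [DecidableEq Q]

/-- The image of a finite set of states under a word. -/
def img (S : Finset Q) (w : List α) : Finset Q := S.image fun q => A.act q w

theorem mem_img {S : Finset Q} {w : List α} {q : Q} : q ∈ A.img S w ↔ ∃ s ∈ S, A.act s w = q :=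
  Finset.mem_image

theorem act_mem_img {S : Finset Q} {q : Q} (h : q ∈ S) (w : List α) : A.act q w ∈ A.img S w :=
  Finset.mem_image_of_mem _ h

theorem img_append (S : Finset Q) (u v : List α) : A.img S (u ++ v) = A.img (A.img S u) v := by
  simp [img, Finset.image_image, Function.comp_def, act_append]

theorem img_subset_img {S T : Finset Q} (h : S ⊆ T) (w : List α) : A.img S w ⊆ A.img T w :=
  Finset.image_subset_image h

theorem card_img_le (S : Finset Q) (w : List α) : (A.img S w).card ≤ S.card :=
  Finset.card_image_le

theorem card_img_lt {S : Finset Q} {w : List α} {s s' : Q} (hs : s ∈ S) (hs' : s' ∈ S)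
    (hne : s ≠ s') (h : A.act s w = A.act s' w) : (A.img S w).card < S.card := by
  refine lt_of_le_of_ne (A.card_img_le S w) fun heq => hne ?_
  exact Finset.card_image_iff.mp heq hs hs' h

theorem exists_merged {S : Finset Q} {w : List α} (h : (A.img S w).card < S.card) :
    ∃ s ∈ S, ∃ s' ∈ S, s ≠ s' ∧ A.act s w = A.act s' w := by
  obtain ⟨x, hx, y, hy, hne, h⟩ := Finset.exists_ne_map_eq_of_card_lt_of_maps_to h
    (f := fun q => A.act q w) fun q hq => A.act_mem_img hq w
  exact ⟨x, hx, y, hy, hne, h⟩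

end Basics

/-! ### The Frankl–Pin compression bound -/

section Compression

variable {α Q : Type*} (A : CompleteAutomaton α Q) [Fintype Q] [DecidableEq Q]

/-- The Frankl–Pin bound: a set missing `k` states is compressed by a word of length at
most `(k + 1) (k + 2) / 2`. -/
theorem exists_compressing_word {S : Finset Q} {w : List α}
    (hw : (A.img S w).card < S.card) {k : ℕ} (hk : Fintype.card Q ≤ S.card + k) :
    ∃ u : List α, u.length ≤ tri k ∧ (A.img S u).card < S.card := by
  classical
  have hex : ∃ m, ∃ u : List α, u.length = m ∧ (A.img S u).card < S.card := ⟨_, w, rfl, hw⟩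
  obtain ⟨u, hum, hu⟩ := Nat.find_spec hex
  have hmin : ∀ v : List α, v.length < u.length → ¬ (A.img S v).card < S.card := fun v hv h =>
    Nat.find_min hex (hum ▸ hv) ⟨v, rfl, h⟩
  refine ⟨u, ?_, hu⟩
  obtain ⟨s, hs, s', hs', hne, hss⟩ := A.exists_merged hu
  refine skew_bollobas_pairs (m := u.length) (fun i => (A.img S (u.take i))ᶜ)
    (fun i => A.act s (u.take i)) (fun i => A.act s' (u.take i)) ?_ ?_ ?_ ?_
  · intro i
    have h1 := hmin (u.take i) (by simp [i.2])
    have h2 := Finset.card_compl (A.img S (u.take i))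
    omega
  · intro i
    simpa using A.act_mem_img hs _
  · intro i
    simpa using A.act_mem_img hs' _
  -- If the merged pair, after `j` letters, lies inside the image after `i < j` letters, then
  -- cutting the letters between `i` and `j` out of `u` still merges two states of `S`, against
  -- minimality.
  · intro i j hij
    by_contra hcon
    simp only [Finset.mem_compl, not_or, not_not] at hcon
    obtain ⟨⟨a, ha, hax⟩, ⟨b, hb, hby⟩⟩ := hcon.imp A.mem_img.mp A.mem_img.mp
    have hij' : (i : ℕ) < j := hij
    have hj := j.2
    refine hmin (u.take i ++ u.drop j) (by simp; omega) (A.card_img_lt ha hb ?_ ?_)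
    · rintro rfl
      refine hmin (u.take j) (by simp) (A.card_img_lt hs hs' hne ?_)
      rw [← hax, ← hby]
    · rw [act_append, act_append, hax, hby, act_take_drop, act_take_drop, hss]

end Compression

/-! ### Avoidable states and their two uses -/

section Avoidance

variable {α Q : Type*} (A : CompleteAutomaton α Q) [Fintype Q] [DecidableEq Q]

/-- The set of states that are avoided by some word of length at most `l`. -/
noncomputable def avoidable (l : ℕ) : Finset Q := by
  classical
  exact Finset.univ.filter fun q => ∃ u : List α, u.length ≤ l ∧ q ∉ A.img Finset.univ u

theorem mem_avoidable {l : ℕ} {q : Q} :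
    q ∈ A.avoidable l ↔ ∃ u : List α, u.length ≤ l ∧ q ∉ A.img Finset.univ u := by
  classical
  simp [avoidable]

theorem avoidable_mono {l l' : ℕ} (h : l ≤ l') : A.avoidable l ⊆ A.avoidable l' := by
  intro q hq
  rw [mem_avoidable] at hq ⊢
  obtain ⟨u, hu, hq⟩ := hq
  exact ⟨u, hu.trans h, hq⟩

/-- The number of states of `S` sent to `p` by the word `w`. -/
def mult (S : Finset Q) (p : Q) (w : List α) : ℕ := (S.filter fun q => A.act q w = p).card

omit [Fintype Q] in
theorem mult_append {S : Finset Q} {u : List α} (hu : (A.img S u).card = S.card) (p : Q)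
    (v : List α) : A.mult S p (u ++ v) = A.mult (A.img S u) p v := by
  have hinj : Set.InjOn (fun q => A.act q u) S := Finset.card_image_iff.mp hu
  have h : (A.img S u).filter (fun q => A.act q v = p) =
      (S.filter fun q => A.act q (u ++ v) = p).image fun q => A.act q u := by
    rw [img, Finset.filter_image]
    simp only [act_append]
  rw [mult, mult, h, Finset.card_image_of_injOn]
  exact hinj.mono (Finset.coe_subset.mpr (Finset.filter_subset _ _))

/-- If `p` cannot be avoided by words of length at most `l`, then the image of a short word can
be compressed by a word whose length is bounded by the number of states avoidable by words of
length at most `l`. -/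
theorem exists_short_compressing_word (hA : ∀ q, ∃ w, ∀ x, A.act x w = q)
    (hQ : 1 < Fintype.card Q) {p : Q} {l : ℕ} (hp : p ∉ A.avoidable l) {y : List α} {c : ℕ}
    (hc : (A.avoidable l).card ≤ c) (hy : y.length + (c + 1) ≤ l) :
    ∃ v : List α, v.length ≤ c + 1 ∧
      (A.img (A.img Finset.univ y) v).card < (A.img Finset.univ y).card := by
  classical
  set Y := A.img Finset.univ y with hYdef
  set E := A.avoidable l with hE
  by_contra hcon
  push Not at hcon
  have hcard : ∀ v : List α, v.length ≤ c + 1 → (A.img Y v).card = Y.card := fun v hv =>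
    le_antisymm (A.card_img_le _ _) (hcon v hv)
  -- A constant word onto `p' ≠ p` has multiplicity zero at `p`, so some shortest `v` has
  -- multiplicity different from one.
  obtain ⟨p', hp'⟩ : ∃ p', p' ≠ p := by
    have := Fintype.one_lt_card_iff_nontrivial.mp hQ
    exact exists_ne p
  obtain ⟨w, hw⟩ := hA p'
  have hex : ∃ m, ∃ v : List α, v.length = m ∧ A.mult Y p v ≠ 1 := by
    refine ⟨_, w, rfl, ?_⟩
    rw [mult, Finset.filter_false_of_mem fun q _ h => hp' (by rw [← h, hw])]
    simp
  obtain ⟨v, hvm, hv⟩ := Nat.find_spec hex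
  have hmin : ∀ x : List α, x.length < v.length → A.mult Y p x = 1 := fun x hx => by
    by_contra h
    exact Nat.find_min hex (hvm ▸ hx) ⟨x, rfl, h⟩
  rcases le_or_gt v.length (c + 1) with hvc | hvc
  · rcases Nat.lt_or_gt_of_ne hv with h0 | h2
    · refine hp (A.mem_avoidable.mpr ⟨y ++ v, by rw [List.length_append]; omega, ?_⟩)
      rw [img_append, mem_img]
      rintro ⟨q, hq, hqp⟩
      have : 0 < A.mult Y p v := Finset.card_pos.mpr ⟨q, Finset.mem_filter.mpr ⟨hq, hqp⟩⟩
      omega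
    · obtain ⟨a, ha, b, hb, hab⟩ := Finset.one_lt_card.mp h2
      rw [Finset.mem_filter] at ha hb
      exact (hcon v hvc).not_gt (A.card_img_lt ha.1 hb.1 hab (ha.2.trans hb.2.symm))
  -- If `v` is long, its first `c + 2` prefixes give images of `Y` whose complements lie in `E`.
  -- They yield `c + 2` independent vectors in a space of dimension `|E| + 1 ≤ c + 1`. The
  -- coordinate `none` carries the constants, so that "multiplicity minus one" becomes a linear
  -- functional.
  · have hsub : ∀ i : Fin (c + 2), (A.img Y (v.take i))ᶜ ⊆ E := by
      intro i q hq
      rw [hE, mem_avoidable]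
      have := i.2
      refine ⟨y ++ v.take i, by rw [List.length_append, List.length_take]; omega, ?_⟩
      rw [img_append]
      exact Finset.mem_compl.mp hq
    let F : Fin (c + 2) → (Option E → ℝ) := fun i =>
      fun o => o.elim 1 fun q => if (q : Q) ∈ A.img Y (v.take i) then 0 else 1
    let B : Fin (c + 2) → Finset Q := fun j => Finset.univ.filter fun q => A.act q (v.drop j) = p
    let φ : Fin (c + 2) → (Option E → ℝ) →ₗ[ℝ] ℝ := fun j =>
      (((B j).card : ℝ) - 1) • LinearMap.proj none -
        ∑ q : E, (if (q : Q) ∈ B j then (1 : ℝ) else 0) • LinearMap.proj (some q)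
    have key : ∀ i j, φ j (F i) = (A.mult (A.img Y (v.take i)) p (v.drop j) : ℝ) - 1 := by
      intro i j
      have h1 : ∑ q : E, (if (q : Q) ∈ B j then (1 : ℝ) else 0) *
          (if (q : Q) ∈ A.img Y (v.take i) then 0 else 1) =
          ((B j \ A.img Y (v.take i)).card : ℝ) := by
        rw [Finset.sum_coe_sort E fun q => (if q ∈ B j then (1 : ℝ) else 0) *
          (if q ∈ A.img Y (v.take i) then 0 else 1)]
        rw [Finset.card_eq_sum_ones, Nat.cast_sum, Nat.cast_one]
        rw [← Finset.sum_subset (s₁ := B j \ A.img Y (v.take i)) (s₂ := E)]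
        · refine Finset.sum_congr rfl fun q hq => ?_
          rw [Finset.mem_sdiff] at hq
          simp [hq.1, hq.2]
        · intro q hq
          exact hsub i (Finset.mem_compl.mpr (Finset.mem_sdiff.mp hq).2)
        · intro q _ hq
          rw [Finset.mem_sdiff, not_and_or, not_not] at hq
          rcases hq with hq | hq <;> simp [hq]
      have h2 : A.mult (A.img Y (v.take i)) p (v.drop j) =
          (B j ∩ A.img Y (v.take i)).card := by
        rw [mult]
        congr 1
        ext q
        simp [B, and_comm]
      have h3 := Finset.card_sdiff_add_card_inter (B j) (A.img Y (v.take i))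
      have h4 : ((B j \ A.img Y (v.take i)).card : ℝ) + ((B j ∩ A.img Y (v.take i)).card : ℝ)
          = (B j).card := by exact_mod_cast h3
      simp only [φ, F, LinearMap.sub_apply, LinearMap.smul_apply, LinearMap.proj_apply,
        LinearMap.sum_apply, smul_eq_mul, Option.elim]
      rw [h1, h2]
      linarith
    have happ : ∀ i j : Fin (c + 2), A.mult (A.img Y (v.take i)) p (v.drop j) =
        A.mult Y p (v.take i ++ v.drop j) := fun i j =>
      (A.mult_append (hcard _ (by rw [List.length_take]; omega)) p _).symm
    have hlin : LinearIndependent ℝ F := by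
      refine linearIndependent_of_triangular F φ ?_ ?_
      -- Below the diagonal the word `v.take i ++ v.drop j` is shorter than `v`, so its multiplicity
      -- is one; on the diagonal it is `v` itself.
      · intro i j hij
        have hij' : (i : ℕ) < j := hij
        have := j.2
        rw [key, happ, hmin _ (by rw [List.length_append, List.length_take, List.length_drop]; omega)]
        simp
      · intro i
        rw [key, happ, List.take_append_drop, sub_ne_zero]
        exact_mod_cast hv
    have := hlin.fintype_card_le_finrank
    simp only [Fintype.card_fin, Module.finrank_fintype_fun_eq_card, Fintype.card_option,
      Fintype.card_coe] at this
    omega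

/-- Few words of length `l` are needed to reduce the rank of a word of large rank once many states
are avoidable. -/
theorem exists_rank_reducing_prefix {w : List α} {e l : ℕ}
    (hw : Fintype.card Q ≤ (A.img Finset.univ w).card + e)
    (hl : 2 * e < (A.avoidable l).card) :
    ∃ u : List α, u.length ≤ l ∧
      (A.img Finset.univ (u ++ w)).card < (A.img Finset.univ w).card := by
  classical
  set R := A.img Finset.univ w with hR
  let fib : Q → Finset Q := fun r => Finset.univ.filter fun q => A.act q w = r
  have hsum : ∑ r ∈ R, (fib r).card = Fintype.card Q := by
    rw [← Finset.card_univ]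
    exact (Finset.card_eq_sum_card_fiberwise fun q hq => A.act_mem_img hq w).symm
  have hpos : ∀ r ∈ R, 1 ≤ (fib r).card := by
    intro r hr
    obtain ⟨q, _, hq⟩ := A.mem_img.mp hr
    exact Finset.card_pos.mpr ⟨q, by simp [fib, hq]⟩
  by_contra hcon
  push Not at hcon
  -- If `q` were alone in its fibre under `w`, prefixing a word that avoids `q` would remove `A.act
  -- q w` from the image.
  have hbig : ∀ q ∈ A.avoidable l, 2 ≤ (fib (A.act q w)).card := by
    intro q hq
    by_contra hlt
    have hqR := A.act_mem_img (Finset.mem_univ q) w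
    have h1 : (fib (A.act q w)).card = 1 := by
      have := hpos _ hqR
      omega
    obtain ⟨u, hu, hqu⟩ := A.mem_avoidable.mp hq
    refine (hcon u hu).not_gt (Finset.card_lt_card ⟨?_, fun hsub => ?_⟩)
    · rw [img_append]
      exact A.img_subset_img (Finset.subset_univ _) w
    · have hmem := hsub hqR
      rw [img_append, mem_img] at hmem
      obtain ⟨q', hq', hqq'⟩ := hmem
      obtain ⟨z, hz⟩ := Finset.card_eq_one.mp h1
      have e1 : q ∈ fib (A.act q w) := by simp [fib]
      have e2 : q' ∈ fib (A.act q w) := by simp [fib, hqq']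
      rw [hz, Finset.mem_singleton] at e1 e2
      exact hqu (e1 ▸ e2 ▸ hq')
  let R₂ := R.filter fun r => 2 ≤ (fib r).card
  have hcover : (A.avoidable l).card ≤ ∑ r ∈ R₂, (fib r).card := by
    rw [← Finset.card_biUnion]
    · refine Finset.card_le_card fun q hq => Finset.mem_biUnion.mpr ⟨A.act q w, ?_, by simp [fib]⟩
      exact Finset.mem_filter.mpr ⟨A.act_mem_img (Finset.mem_univ q) w, hbig q hq⟩
    · intro r _ r' _ hne
      rw [Function.onFun, Finset.disjoint_left]
      intro q hq hq'
      exact hne ((Finset.mem_filter.mp hq).2.symm.trans (Finset.mem_filter.mp hq').2)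
  -- For `m ≥ 2` one has `m ≤ 2(m - 1)`. The excesses `m - 1` sum to `n - |R| ≤ e`, so at most `2e`
  -- states lie in non-singleton fibres.
  have h2 : ∑ r ∈ R₂, (fib r).card ≤ ∑ r ∈ R₂, 2 * ((fib r).card - 1) := by
    refine Finset.sum_le_sum fun r hr => ?_
    have := (Finset.mem_filter.mp hr).2
    omega
  have h3 : ∑ r ∈ R₂, 2 * ((fib r).card - 1) ≤ ∑ r ∈ R, 2 * ((fib r).card - 1) :=
    Finset.sum_le_sum_of_subset (Finset.filter_subset _ _)
  have h4 : ∑ r ∈ R, ((fib r).card - 1) + R.card = Fintype.card Q := by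
    rw [← hsum, Finset.card_eq_sum_ones, ← Finset.sum_add_distrib]
    refine Finset.sum_congr rfl fun r hr => ?_
    have := hpos r hr
    omega
  have h5 : ∑ r ∈ R, 2 * ((fib r).card - 1) = 2 * ∑ r ∈ R, ((fib r).card - 1) :=
    (Finset.mul_sum _ _ _).symm
  omega

end Avoidance

end CompleteAutomaton

/-- The number of indices `l < a` with `ε l ≤ 2 e`. -/
def countLE (ε : ℕ → ℕ) (a e : ℕ) : ℕ := ((Finset.range a).filter fun l => ε l ≤ 2 * e).card

theorem countLE_le (ε : ℕ → ℕ) (a e : ℕ) : countLE ε a e ≤ a :=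
  (Finset.card_filter_le _ _).trans_eq (Finset.card_range a)

/-- By monotonicity the counted indices form an initial segment, so their number is the first index
at which `ε` exceeds `2e`, provided this occurs before `a`. -/
theorem lt_apply_countLE {ε : ℕ → ℕ} (hε : Monotone ε) {a e : ℕ} (h : countLE ε a e < a) :
    2 * e < ε (countLE ε a e) := by
  by_contra hcon
  push Not at hcon
  have hsub : Finset.range (countLE ε a e + 1) ⊆ (Finset.range a).filter fun l => ε l ≤ 2 * e := by
    intro l hl
    rw [Finset.mem_range] at hl
    rw [Finset.mem_filter, Finset.mem_range]
    exact ⟨by omega, (hε (by omega)).trans hcon⟩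
  have := Finset.card_le_card hsub
  rw [Finset.card_range] at this
  exact absurd this (by unfold countLE; omega)

/-- The cost of decreasing the rank from `n - e`, when `ε l` states are avoidable by words of
length at most `l`. -/
def stepCost (ε : ℕ → ℕ) (n a e : ℕ) : ℕ :=
  if 2 * e < n then min (tri e) (countLE ε a e) else tri e

namespace CompleteAutomaton

/-! ### Building a reset word when every state is a reset target -/

section StronglyConnected

variable {α Q : Type*} (A : CompleteAutomaton α Q) [Fintype Q] [DecidableEq Q]

/-- Compress greedily. A step at time `t` takes `M + 1` units of time, where `M` is read off at `t +
(n + 1)` so that the unavoidable state remains so throughout the step. Over this interval each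
summand is at most `1/(M + 1)` by monotonicity, so the sum grows by at most one while the deficit
grows by one. The floor `κ` on `M` keeps the early summands small. -/
theorem exists_word_of_rank_deficit (hA : ∀ q, ∃ w, ∀ x, A.act x w = q)
    (hQ : 1 < Fintype.card Q) {a κ : ℕ} (hκ : κ ≤ Fintype.card Q)
    (ha : ∀ l < a, A.avoidable l ≠ Finset.univ) :
    ∃ (k : ℕ) (w : List α), w.length ≤ a ∧ (A.img Finset.univ w).card + k ≤ Fintype.card Q ∧
      ∑ i ∈ Finset.range (a - (Fintype.card Q + 1)),
        (1 : ℝ) / ((max (A.avoidable (i + (Fintype.card Q + 1))).card κ : ℕ) + 1) ≤ k := by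
  set n := Fintype.card Q with hn
  set g : ℕ → ℝ := fun i => (1 : ℝ) / ((max (A.avoidable (i + (n + 1))).card κ : ℕ) + 1) with hg
  have hg0 : ∀ i, 0 ≤ g i := fun i => by positivity
  have claim : ∀ d : ℕ, ∃ (k t : ℕ) (w : List α), w.length ≤ t ∧ t ≤ a ∧
      (A.img Finset.univ w).card + k ≤ n ∧ ∑ i ∈ Finset.range t, g i ≤ k ∧
      (a ≤ t + (n + 1) ∨ d ≤ k) := by
    intro d
    induction d with
    | zero => exact ⟨0, 0, [], by simp, by simp, Finset.card_le_univ _, by simp, by simp⟩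
    | succ d ih =>
      obtain ⟨k, t, w, hwt, hta, hk, hsum, h⟩ := ih
      by_cases hat : a ≤ t + (n + 1)
      · exact ⟨k, t, w, hwt, hta, hk, hsum, Or.inl hat⟩
      have hdk := h.resolve_left hat
      push Not at hat
      obtain ⟨p, hp⟩ : ∃ p, p ∉ A.avoidable (t + (n + 1)) := by
        by_contra hcon
        push Not at hcon
        exact ha _ hat (Finset.eq_univ_iff_forall.mpr hcon)
      set M := max (A.avoidable (t + (n + 1))).card κ with hM
      have hMn : M ≤ n := max_le (Finset.card_le_univ _) hκ
      obtain ⟨v, hv, hlt⟩ := A.exists_short_compressing_word hA hQ hp (y := w) (c := M)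
        (le_max_left _ _) (by omega)
      refine ⟨k + 1, t + (M + 1), w ++ v, by rw [List.length_append]; omega, by omega, ?_, ?_,
        Or.inr (by omega)⟩
      · rw [img_append]
        omega
      · rw [Finset.sum_range_add]
        have hle : ∑ i ∈ Finset.range (M + 1), g (t + i) ≤
            ∑ i ∈ Finset.range (M + 1), (1 : ℝ) / (M + 1) := by
          refine Finset.sum_le_sum fun i _ => ?_
          refine one_div_le_one_div_of_le (by positivity) ?_
          have : M ≤ max (A.avoidable (t + i + (n + 1))).card κ :=
            max_le_max (Finset.card_le_card (A.avoidable_mono (by omega))) le_rfl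
          exact_mod_cast Nat.succ_le_succ this
        have h1 : ∑ i ∈ Finset.range (M + 1), (1 : ℝ) / (M + 1) = 1 := by
          rw [Finset.sum_const, Finset.card_range, nsmul_eq_mul]
          push_cast
          field_simp
        push_cast
        linarith
  obtain ⟨k, t, w, hwt, hta, hk, hsum, h⟩ := claim (n + 1)
  have hat : a ≤ t + (n + 1) := h.resolve_right (by omega)
  refine ⟨k, w, hwt.trans hta, hk, le_trans ?_ hsum⟩
  exact Finset.sum_le_sum_of_subset_of_nonneg (Finset.range_mono (by omega)) fun i _ _ => hg0 i

theorem exists_word_of_steps {c : ℕ → ℕ}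
    (hstep : ∀ (w : List α) (e : ℕ), (A.img Finset.univ w).card + e = Fintype.card Q →
      e + 2 ≤ Fintype.card Q → ∃ w' : List α, w'.length ≤ w.length + c e ∧
        (A.img Finset.univ w').card < (A.img Finset.univ w).card)
    {w : List α} {k j : ℕ} (hk : (A.img Finset.univ w).card + k ≤ Fintype.card Q) (hkj : k ≤ j)
    (hj : j + 1 ≤ Fintype.card Q) :
    ∃ w' : List α, w'.length ≤ w.length + ∑ e ∈ Finset.Ico k j, c e ∧
      (A.img Finset.univ w').card + j ≤ Fintype.card Q := by
  induction j, hkj using Nat.le_induction with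
  | base => exact ⟨w, by simp, hk⟩
  | succ j hkj ih =>
    obtain ⟨w', hw', hr⟩ := ih (by omega)
    rw [Finset.sum_Ico_succ_top hkj]
    by_cases h : (A.img Finset.univ w').card + (j + 1) ≤ Fintype.card Q
    · exact ⟨w', by omega, h⟩
    · obtain ⟨w'', hw'', hlt⟩ := hstep w' j (by omega) (by omega)
      exact ⟨w'', by omega, by omega⟩

theorem exists_step (hA : ∀ q, ∃ w, ∀ x, A.act x w = q) {a : ℕ}
    (ha : A.avoidable a = Finset.univ ∨ ∀ e, 2 * e < Fintype.card Q → tri e ≤ a)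
    (w : List α) (e : ℕ) (hw : (A.img Finset.univ w).card + e = Fintype.card Q)
    (he : e + 2 ≤ Fintype.card Q) :
    ∃ w' : List α,
      w'.length ≤ w.length + stepCost (fun l => (A.avoidable l).card) (Fintype.card Q) a e ∧
        (A.img Finset.univ w').card < (A.img Finset.univ w).card := by
  set ε : ℕ → ℕ := fun l => (A.avoidable l).card with hε
  have hmono : Monotone ε := fun _ _ h => Finset.card_le_card (A.avoidable_mono h)
  have hpin : ∃ w' : List α, w'.length ≤ w.length + tri e ∧
      (A.img Finset.univ w').card < (A.img Finset.univ w).card := by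
    have hne : (Finset.univ : Finset Q).Nonempty :=
      Finset.univ_nonempty_iff.mpr (Fintype.card_pos_iff.mp (by omega))
    obtain ⟨w₀, hw₀⟩ := hA hne.choose
    have h1 : (A.img (A.img Finset.univ w) w₀).card ≤ 1 := by
      refine Finset.card_le_one.mpr fun x hx y hy => ?_
      obtain ⟨s, _, rfl⟩ := A.mem_img.mp hx
      obtain ⟨s', _, rfl⟩ := A.mem_img.mp hy
      rw [hw₀, hw₀]
    obtain ⟨u, hu, hlt⟩ := A.exists_compressing_word (S := A.img Finset.univ w) (w := w₀) (k := e)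
      (by omega) (by omega)
    exact ⟨w ++ u, by rw [List.length_append]; omega, by rwa [img_append]⟩
  have havoid : 2 * e < ε (countLE ε a e) → ∃ w' : List α,
      w'.length ≤ w.length + countLE ε a e ∧
        (A.img Finset.univ w').card < (A.img Finset.univ w).card := by
    intro h
    obtain ⟨u, hu, hlt⟩ := A.exists_rank_reducing_prefix (w := w) (e := e) (by omega) h
    exact ⟨u ++ w, by rw [List.length_append]; omega, hlt⟩
  unfold stepCost
  split_ifs with h2
  · rcases le_total (tri e) (countLE ε a e) with h | h
    · rwa [min_eq_left h]
    · rw [min_eq_right h]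
      rcases (countLE_le ε a e).lt_or_eq with hlt | heq
      · exact havoid (lt_apply_countLE hmono hlt)
      -- Here the count has reached its cap `a`. Either all states are avoidable at length `a`, or
      -- `a` is at least `tri e` and the Frankl–Pin step is no longer than `a`.
      · rcases ha with ha | ha
        · refine havoid ?_
          rw [heq]
          simp only [hε, ha, Finset.card_univ]
          exact h2
        · have hte : tri e = countLE ε a e := le_antisymm ((ha e h2).trans_eq heq.symm) h
          rwa [← hte]
  · exact hpin

/-- The combinatorial outcome of the argument: for an automaton in which every state is the image
of a constant word, there is a reset word whose length is bounded in terms of the numbers `ε l`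
of states avoidable by words of length at most `l`. -/
theorem exists_reset_word_le_sum (hA : ∀ q, ∃ w, ∀ x, A.act x w = q)
    (hQ : 1 < Fintype.card Q) {κ b : ℕ} (hκ : κ ≤ Fintype.card Q)
    (hb : ∀ e, 2 * e < Fintype.card Q → tri e ≤ b) :
    ∃ (ε : ℕ → ℕ) (a k : ℕ) (w : List α) (q : Q), (∀ x, A.act x w = q) ∧ a ≤ b ∧
      (∀ l, ε l ≤ Fintype.card Q) ∧
      ∑ i ∈ Finset.range (a - (Fintype.card Q + 1)),
        (1 : ℝ) / ((max (ε (i + (Fintype.card Q + 1))) κ : ℕ) + 1) ≤ k ∧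
      w.length ≤ a + ∑ e ∈ Finset.Ico k (Fintype.card Q - 1),
        stepCost ε (Fintype.card Q) a e := by
  classical
  -- The length `a` is where full avoidability is reached; the cap `b` stops the search once
  -- Frankl–Pin is at least as good for every `e < n/2`.
  have hex : ∃ a, A.avoidable a = Finset.univ ∨ b ≤ a := ⟨b, Or.inr le_rfl⟩
  set a := Nat.find hex with ha
  have hab : a ≤ b := Nat.find_min' hex (Or.inr le_rfl)
  have hspec : A.avoidable a = Finset.univ ∨ ∀ e, 2 * e < Fintype.card Q → tri e ≤ a :=
    (Nat.find_spec hex).imp_right fun h e he => (hb e he).trans h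
  obtain ⟨k, w, hwa, hk, hsum⟩ := A.exists_word_of_rank_deficit hA hQ hκ
    (a := a) fun l hl h => Nat.find_min hex hl (Or.inl h)
  have hpos : ∀ w : List α, 0 < (A.img Finset.univ w).card := by
    intro w
    obtain ⟨q⟩ := Fintype.card_pos_iff.mp (zero_lt_one.trans hQ)
    exact Finset.card_pos.mpr ⟨_, A.act_mem_img (Finset.mem_univ q) w⟩
  have hkn := hpos w
  obtain ⟨w', hw', hr⟩ := A.exists_word_of_steps (A.exists_step hA hspec) hk
    (j := Fintype.card Q - 1) (by omega) (by omega)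
  have hone : (A.img Finset.univ w').card = 1 := by
    have := hpos w'
    omega
  obtain ⟨q, hq⟩ := Finset.card_eq_one.mp hone
  refine ⟨_, a, k, w', q, fun x => ?_, hab, fun l => Finset.card_le_univ _, hsum,
    hw'.trans (by omega)⟩
  have := A.act_mem_img (Finset.mem_univ x) w'
  rwa [hq, Finset.mem_singleton] at this

end StronglyConnected

/-! ### Reduction to the states reachable from a reset target -/

section Reduction

variable {α Q : Type*} (A : CompleteAutomaton α Q)

theorem exists_short_path [Fintype Q] {R : Set Q} {q : Q} (h : ∃ w : List α, A.act q w ∈ R) :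
    ∃ w : List α, w.length ≤ Fintype.card Q ∧ A.act q w ∈ R := by
  classical
  have hex : ∃ m, ∃ w : List α, w.length = m ∧ A.act q w ∈ R := h.imp' _ fun w hw => ⟨w, rfl, hw⟩
  obtain ⟨w, hwm, hw⟩ := Nat.find_spec hex
  refine ⟨w, ?_, hw⟩
  by_contra hlt
  push Not at hlt
  have hcard : Fintype.card Q < Fintype.card (Fin w.length) := by rwa [Fintype.card_fin]
  obtain ⟨i, j, hne, hij⟩ := Fintype.exists_ne_map_eq_of_card_lt
    (fun i : Fin w.length => A.act q (w.take i)) hcard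
  wlog hlt' : i < j generalizing i j
  · exact this j i hne.symm hij.symm (lt_of_le_of_ne (not_lt.mp hlt') hne.symm)
  have hlt'' : (i : ℕ) < j := hlt'
  have := j.2
  refine Nat.find_min hex (m := (w.take i ++ w.drop j).length) ?_ ⟨_, rfl, ?_⟩
  · rw [← hwm, List.length_append, List.length_take, List.length_drop]
    omega
  · rw [act_append]
    rw [hij, act_take_drop]
    exact hw

/-- States are driven into `R` one after another; closedness of `R` keeps those already inside. -/
theorem exists_word_into [Fintype Q] {R : Set Q} (hR : ∀ q ∈ R, ∀ x, A.step q x ∈ R)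
    (h : ∀ q, ∃ w : List α, A.act q w ∈ R) :
    ∃ w : List α, w.length ≤ Fintype.card Q * Fintype.card Q ∧ ∀ q, A.act q w ∈ R := by
  classical
  have hact : ∀ (w : List α), ∀ q ∈ R, A.act q w ∈ R := by
    intro w
    induction w with
    | nil => exact fun q hq => hq
    | cons x w ih => exact fun q hq => ih _ (hR q hq x)
  have key : ∀ S : Finset Q, ∃ w : List α, w.length ≤ S.card * Fintype.card Q ∧
      ∀ q ∈ S, A.act q w ∈ R := by
    intro S
    induction S using Finset.induction_on with
    | empty => exact ⟨[], by simp, by simp⟩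
    | insert q S hq ih =>
      obtain ⟨w, hw, hS⟩ := ih
      obtain ⟨v, hv, hqv⟩ := A.exists_short_path (h (A.act q w))
      refine ⟨w ++ v, ?_, ?_⟩
      · rw [List.length_append, Finset.card_insert_of_notMem hq, add_mul, one_mul]
        omega
      · intro q' hq'
        rw [act_append]
        rcases Finset.mem_insert.mp hq' with rfl | hq'
        · exact hqv
        · exact hact _ _ (hS q' hq')
  obtain ⟨w, hw, hS⟩ := key Finset.univ
  exact ⟨w, by simpa using hw, fun q => hS q (Finset.mem_univ q)⟩

/-- The restriction of an automaton to a set of states closed under all letters. -/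
def restrict {R : Set Q} (hR : ∀ q ∈ R, ∀ x, A.step q x ∈ R) : CompleteAutomaton α R where
  step q x := ⟨A.step q x, hR q q.2 x⟩

theorem coe_act_restrict {R : Set Q} (hR : ∀ q ∈ R, ∀ x, A.step q x ∈ R) (q : R) (w : List α) :
    ((A.restrict hR).act q w : Q) = A.act q w := by
  induction w generalizing q with
  | nil => rfl
  | cons x w ih => exact ih ⟨A.step q x, hR q q.2 x⟩

theorem IsSynchronizing.exists_reset_word {A : CompleteAutomaton α Q} (h : A.IsSynchronizing) :
    ∃ (w : List α) (q : Q), ∀ x, A.act x w = q := by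
  have hmem : A.rank ∈ Set.range A.wordRank := Nat.sInf_mem (Set.range_nonempty _)
  rw [h] at hmem
  obtain ⟨w, hw⟩ := hmem
  obtain ⟨q, hq⟩ := Set.ncard_eq_one.mp hw
  refine ⟨w, q, fun x => ?_⟩
  have : A.act x w ∈ A.image Set.univ w := ⟨x, Set.mem_univ x, rfl⟩
  rwa [hq] at this

theorem resetThreshold_le [Nonempty Q] {w : List α} {q : Q} (h : ∀ x, A.act x w = q) :
    A.resetThreshold ≤ w.length := by
  refine Nat.sInf_le ⟨w, ?_, rfl⟩
  have : A.image Set.univ w = {q} := by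
    ext y
    simp only [image, Set.image_univ, Set.mem_range, Set.mem_singleton_iff, h, exists_const]
    exact eq_comm
  rw [wordRank, this, Set.ncard_singleton]

/-- A monotone bound on the length of reset words, valid for strongly connected automata, holds up
to a quadratic term for all synchronizing automata. -/
theorem IsSynchronizing.resetThreshold_le_add {A : CompleteAutomaton α Q} [Finite Q]
    (h : A.IsSynchronizing) {β : ℕ → ℝ} (hβ : Monotone β)
    (hbound : ∀ (R : Set Q) (B : CompleteAutomaton α R), R.Nonempty →
      (∀ q, ∃ w : List α, ∀ x, B.act x w = q) →
      ∃ (w : List α) (q : R), (∀ x, B.act x w = q) ∧ (w.length : ℝ) ≤ β (Nat.card R)) :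
    (A.resetThreshold : ℝ) ≤ (Nat.card Q : ℝ) ^ 2 + β (Nat.card Q) := by
  classical
  cases nonempty_fintype Q
  obtain ⟨w₀, q₀, h₀⟩ := h.exists_reset_word
  let R : Set Q := {q | ∃ v : List α, A.act q₀ v = q}
  have hR : ∀ q ∈ R, ∀ x, A.step q x ∈ R := by
    rintro q ⟨v, rfl⟩ x
    exact ⟨v ++ [x], by rw [act_append]; rfl⟩
  have hq₀ : q₀ ∈ R := ⟨[], rfl⟩
  obtain ⟨w₁, hw₁, h₁⟩ := A.exists_word_into hR fun q => ⟨w₀, by rw [h₀]; exact hq₀⟩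
  obtain ⟨w₂, q, h₂, hw₂⟩ := hbound R (A.restrict hR) ⟨q₀, hq₀⟩ (by
    rintro ⟨q, v, rfl⟩
    refine ⟨w₀ ++ v, fun x => Subtype.ext ?_⟩
    rw [coe_act_restrict, act_append, h₀])
  have : Nonempty Q := ⟨q₀⟩
  have hle := A.resetThreshold_le (w := w₁ ++ w₂) (q := q) fun x => by
    rw [act_append, ← A.coe_act_restrict hR ⟨_, h₁ x⟩, h₂]
  have hcard : Nat.card R ≤ Nat.card Q := Nat.card_le_card_of_injective _ Subtype.val_injective
  have h3 := hβ hcard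
  rw [List.length_append] at hle
  have hle' : (A.resetThreshold : ℝ) ≤ w₁.length + w₂.length := by exact_mod_cast hle
  have hw₁' : (w₁.length : ℝ) ≤ (Nat.card Q : ℝ) ^ 2 := by
    rw [Nat.card_eq_fintype_card, sq]
    exact_mod_cast hw₁
  linarith

end Reduction

end CompleteAutomaton

/-! ### The extremal problem for the step costs -/

section Estimates

/-- The sum telescopes, because `1/(2(e+1)²) ≤ 1/(2e+1) - 1/(2e+3)`. -/
theorem sum_inv_sq_le {x h : ℕ} (hx : x ≤ 2 * h) :
    ∑ e ∈ Finset.range h, (if x ≤ 2 * e then (1 : ℝ) / (2 * ((e : ℝ) + 1) ^ 2) else 0) ≤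
      1 / ((x : ℝ) + 1) - 1 / (2 * h + 1) := by
  induction h with
  | zero =>
    obtain rfl : x = 0 := by omega
    simp
  | succ h ih =>
    rw [Finset.sum_range_succ]
    by_cases hxh : x ≤ 2 * h
    · rw [if_pos hxh]
      have h1 := ih hxh
      have h2 : (1 : ℝ) / (2 * ((h : ℝ) + 1) ^ 2) ≤ 1 / (2 * h + 1) - 1 / (2 * (h + 1) + 1) := by
        rw [div_sub_div _ _ (by positivity) (by positivity),
          div_le_div_iff₀ (by positivity) (by positivity)]
        nlinarith
      push_cast
      linarith
    · rw [if_neg hxh, add_zero, Finset.sum_eq_zero fun e he => ?_]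
      · rw [sub_nonneg]
        refine one_div_le_one_div_of_le (by positivity) ?_
        have : (x : ℝ) ≤ 2 * ((h + 1 : ℕ) : ℝ) := by exact_mod_cast hx
        linarith
      · rw [Finset.mem_range] at he
        exact if_neg (by omega)

/-- Each `1/(ε l + 1)` is split into layers indexed by `e`, and the summations over `l` and `e` are
exchanged. For `e ≥ κ` the floor `κ` does not affect the condition `ε l ≤ 2e`. -/
theorem sum_countLE_le {ε : ℕ → ℕ} {a κ h : ℕ} (hε : ∀ l, ε l ≤ 2 * h) (hκ : κ ≤ 2 * h) :
    (a : ℝ) / (2 * h + 1) +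
        ∑ e ∈ Finset.Ico κ h, (countLE ε a e : ℝ) * (1 / (2 * ((e : ℝ) + 1) ^ 2)) ≤
      ∑ l ∈ Finset.range a, (1 : ℝ) / ((max (ε l) κ : ℕ) + 1) := by
  have h1 : ∀ e, (countLE ε a e : ℝ) * (1 / (2 * ((e : ℝ) + 1) ^ 2)) =
      ∑ l ∈ Finset.range a, if ε l ≤ 2 * e then (1 : ℝ) / (2 * ((e : ℝ) + 1) ^ 2) else 0 := by
    intro e
    rw [countLE, ← Finset.sum_filter, Finset.sum_const, nsmul_eq_mul]
  have h2 : (a : ℝ) / (2 * h + 1) = ∑ l ∈ Finset.range a, (1 : ℝ) / (2 * h + 1) := by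
    rw [Finset.sum_const, Finset.card_range, nsmul_eq_mul, mul_one_div]
  simp only [h1]
  rw [Finset.sum_comm, h2, ← Finset.sum_add_distrib]
  refine Finset.sum_le_sum fun l _ => ?_
  have h3 := sum_inv_sq_le (x := max (ε l) κ) (h := h) (max_le (hε l) hκ)
  have h4 : ∑ e ∈ Finset.Ico κ h,
      (if ε l ≤ 2 * e then (1 : ℝ) / (2 * ((e : ℝ) + 1) ^ 2) else 0) ≤
      ∑ e ∈ Finset.range h,
        if max (ε l) κ ≤ 2 * e then (1 : ℝ) / (2 * ((e : ℝ) + 1) ^ 2) else 0 := by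
    rw [Finset.range_eq_Ico]
    refine (Finset.sum_le_sum fun e he => ?_).trans (Finset.sum_le_sum_of_subset_of_nonneg
      (Finset.Ico_subset_Ico_left (Nat.zero_le κ)) fun e _ _ => ?_)
    · rw [Finset.mem_Ico] at he
      by_cases hle : ε l ≤ 2 * e
      · rw [if_pos hle, if_pos (max_le hle (by omega))]
      · rw [if_neg hle]
        split_ifs <;> positivity
    · split_ifs <;> positivity
  linarith

theorem sum_one_div_le_shift {g : ℕ → ℕ} {a m κ : ℕ} :
    ∑ l ∈ Finset.range a, (1 : ℝ) / ((max (g l) κ : ℕ) + 1) ≤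
      ∑ i ∈ Finset.range (a - m), (1 : ℝ) / ((max (g (i + m)) κ : ℕ) + 1) + m / (κ + 1) := by
  have hterm : ∀ l, (1 : ℝ) / ((max (g l) κ : ℕ) + 1) ≤ 1 / (κ + 1) := fun l =>
    one_div_le_one_div_of_le (by positivity)
      (by exact_mod_cast Nat.succ_le_succ (le_max_right (g l) κ))
  have hsum : ∑ l ∈ Finset.range m, (1 : ℝ) / ((max (g l) κ : ℕ) + 1) ≤ m / (κ + 1) := by
    refine (Finset.sum_le_sum fun l _ => hterm l).trans_eq ?_
    rw [Finset.sum_const, Finset.card_range, nsmul_eq_mul, mul_one_div]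
  have hsub : Finset.range a ⊆ Finset.range (m + (a - m)) := Finset.range_mono (by omega)
  refine (Finset.sum_le_sum_of_subset_of_nonneg hsub fun _ _ _ => by positivity).trans ?_
  rw [Finset.sum_range_add, add_comm]
  simp only [add_comm m]
  exact add_le_add le_rfl hsum

theorem sum_sq_div_two_le (T : ℕ) :
    ∑ t ∈ Finset.range T, ((t : ℝ) + 1) ^ 2 / 2 ≤ (T : ℝ) ^ 3 / 6 + T ^ 2 := by
  induction T with
  | zero => simp
  | succ T ih =>
    rw [Finset.sum_range_succ]
    push_cast
    nlinarith [(Nat.cast_nonneg T : (0 : ℝ) ≤ T)]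

theorem le_sum_sq_div_two (T : ℕ) :
    (T : ℝ) ^ 3 / 6 ≤ ∑ t ∈ Finset.range T, ((t : ℝ) + 1) ^ 2 / 2 := by
  induction T with
  | zero => simp
  | succ T ih =>
    rw [Finset.sum_range_succ]
    push_cast
    nlinarith [(Nat.cast_nonneg T : (0 : ℝ) ≤ T)]

theorem sum_sq_sub_sq_le {y : ℝ} (hy : 0 ≤ y) (T : ℕ) (hT : y ≤ T) :
    ∑ t ∈ Finset.range T, max 0 ((((t : ℝ) + 1) ^ 2 - y ^ 2) / 2) ≤
      ((T : ℝ) ^ 3 - y ^ 3) / 6 - y ^ 2 * (T - y) / 2 + T ^ 2 := by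
  induction T with
  | zero =>
    have : y = 0 := le_antisymm (by simpa using hT) hy
    simp [this]
  | succ T ih =>
    rw [Finset.sum_range_succ]
    push_cast at hT ⊢
    have hT0 : (0 : ℝ) ≤ T := Nat.cast_nonneg T
    have hmax : max 0 ((((T : ℝ) + 1) ^ 2 - y ^ 2) / 2) = (((T : ℝ) + 1) ^ 2 - y ^ 2) / 2 :=
      max_eq_right (by nlinarith)
    rw [hmax]
    rcases le_or_gt y (T : ℝ) with h | h
    · have := ih h
      nlinarith
    · rw [Finset.sum_eq_zero fun t ht => ?_]
      · have h1 : ((T : ℝ) + 1) ^ 2 - y ^ 2 ≤ 2 * T + 1 := by nlinarith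
        have h2 : 0 ≤ (((T : ℝ) + 1) ^ 3 - y ^ 3) / 6 - y ^ 2 * (T + 1 - y) / 2 := by
          have : (((T : ℝ) + 1) ^ 3 - y ^ 3) / 6 - y ^ 2 * (T + 1 - y) / 2 =
              (T + 1 - y) ^ 2 * (T + 1 + 2 * y) / 6 := by ring
          rw [this]
          positivity
        nlinarith
      · rw [Finset.mem_range] at ht
        refine max_eq_left ?_
        have : (t : ℝ) + 1 ≤ T := by exact_mod_cast ht
        nlinarith [(Nat.cast_nonneg t : (0 : ℝ) ≤ t)]

theorem le_sum_inv_sq {s h : ℕ} (hsh : s ≤ h) :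
    (1 : ℝ) / (s + 1) - 1 / (h + 1) ≤ ∑ t ∈ Finset.Ico s h, (1 : ℝ) / ((t : ℝ) + 1) ^ 2 := by
  induction h, hsh using Nat.le_induction with
  | base => simp
  | succ h hsh ih =>
    rw [Finset.sum_Ico_succ_top hsh]
    have : (1 : ℝ) / (h + 1) - 1 / ((h + 1 : ℕ) + 1) ≤ 1 / ((h : ℝ) + 1) ^ 2 := by
      push_cast
      rw [div_sub_div _ _ (by positivity) (by positivity),
        div_le_div_iff₀ (by positivity) (by positivity)]
      nlinarith [(Nat.cast_nonneg h : (0 : ℝ) ≤ h)]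
    linarith

/-- A sequence bounded by `min (t², s²) / 2` up to an error `δ`, summed from `k ≥ 2 s / 5`. -/
theorem sum_le_of_large {f : ℕ → ℝ} {k h s : ℕ} {δ : ℝ} (hδ : 0 ≤ δ) (hsh : s ≤ h)
    (hf1 : ∀ e < h, f e ≤ ((e : ℝ) + 1) ^ 2 / 2 + δ) (hf2 : ∀ e < h, f e ≤ (s : ℝ) ^ 2 / 2 + δ)
    (hk : 2 / 5 * (s : ℝ) ≤ k) :
    ∑ e ∈ Finset.Ico k h, f e ≤
      h * δ + ((s : ℝ) ^ 3 - (2 / 5 * s) ^ 3) / 6 + (h - s) * s ^ 2 / 2 + s ^ 2 := by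
  have hsh' : (s : ℝ) ≤ h := by exact_mod_cast hsh
  have hs0 : (0 : ℝ) ≤ s := Nat.cast_nonneg s
  have hnn : 0 ≤ (h - s : ℝ) * s ^ 2 / 2 := by
    have := sub_nonneg.mpr hsh'
    positivity
  set y : ℝ := 2 / 5 * s with hy
  have hy0 : 0 ≤ y := by positivity
  have hδsum : ∀ S : Finset ℕ, S ⊆ Finset.range h → ∑ _e ∈ S, δ ≤ h * δ := by
    intro S hS
    rw [Finset.sum_const, nsmul_eq_mul]
    have : S.card ≤ h := (Finset.card_le_card hS).trans_eq (Finset.card_range h)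
    exact mul_le_mul_of_nonneg_right (by exact_mod_cast this) hδ
  rcases le_or_gt k s with hks | hks
  · have hsplit := Finset.sum_Ico_consecutive f hks hsh
    have h1 : ∑ e ∈ Finset.Ico k s, f e ≤
        ∑ e ∈ Finset.Ico k s, ((e : ℝ) + 1) ^ 2 / 2 + ∑ _e ∈ Finset.Ico k s, δ := by
      rw [← Finset.sum_add_distrib]
      exact Finset.sum_le_sum fun e he => hf1 e (by rw [Finset.mem_Ico] at he; omega)
    have h2 : ∑ e ∈ Finset.Ico s h, f e ≤
        ∑ _e ∈ Finset.Ico s h, (s : ℝ) ^ 2 / 2 + ∑ _e ∈ Finset.Ico s h, δ := by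
      rw [← Finset.sum_add_distrib]
      exact Finset.sum_le_sum fun e he => hf2 e (by rw [Finset.mem_Ico] at he; omega)
    have h3 := Finset.sum_Ico_consecutive (fun _ => δ) hks hsh
    have h4 := hδsum (Finset.Ico k h) fun e he => by
      rw [Finset.mem_Ico] at he
      exact Finset.mem_range.mpr he.2
    have h5 : ∑ _e ∈ Finset.Ico s h, (s : ℝ) ^ 2 / 2 = ((h : ℝ) - s) * (s : ℝ) ^ 2 / 2 := by
      rw [Finset.sum_const, Nat.card_Ico, nsmul_eq_mul, Nat.cast_sub hsh]
      ring
    have h6 := Finset.sum_range_add_sum_Ico (fun e : ℕ => ((e : ℝ) + 1) ^ 2 / 2) hks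
    have h7 := sum_sq_div_two_le s
    have h8 := le_sum_sq_div_two k
    have h9 : y ^ 3 ≤ (k : ℝ) ^ 3 := pow_le_pow_left₀ hy0 hk 3
    linarith
  · have h2 : ∑ e ∈ Finset.Ico k h, f e ≤
        ∑ _e ∈ Finset.Ico k h, (s : ℝ) ^ 2 / 2 + ∑ _e ∈ Finset.Ico k h, δ := by
      rw [← Finset.sum_add_distrib]
      exact Finset.sum_le_sum fun e he => hf2 e (by rw [Finset.mem_Ico] at he; omega)
    have h4 := hδsum (Finset.Ico k h) fun e he => by
      rw [Finset.mem_Ico] at he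
      exact Finset.mem_range.mpr he.2
    have h5 : ∑ _e ∈ Finset.Ico k h, (s : ℝ) ^ 2 / 2 ≤ ((h : ℝ) - s) * (s : ℝ) ^ 2 / 2 := by
      rw [Finset.sum_const, Nat.card_Ico, nsmul_eq_mul, mul_div_assoc]
      refine mul_le_mul_of_nonneg_right ?_ (by positivity)
      rw [← Nat.cast_sub hsh]
      exact_mod_cast Nat.sub_le_sub_left hks.le h
    have h9 : y ^ 3 ≤ (s : ℝ) ^ 3 := pow_le_pow_left₀ hy0 (by rw [hy]; linarith) 3
    have h10 : (0 : ℝ) ≤ (s : ℝ) ^ 2 := by positivity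
    linarith

/-- This is the dual side of the linear program: the cap `min(t², s²)/2` weighted by the positive
part of the reduced cost `1 - y²/t²`, which is zero for `t ≤ y`. -/
theorem sum_weighted_le {s h : ℕ} (hs : 0 < s) (hsh : s ≤ h) {y : ℝ} (hy : 0 ≤ y) (hys : y ≤ s) :
    ∑ t ∈ Finset.range h, min (((t : ℝ) + 1) ^ 2) ((s : ℝ) ^ 2) / 2 *
        max 0 (1 - y ^ 2 / ((t : ℝ) + 1) ^ 2) ≤
      ((s : ℝ) ^ 3 - y ^ 3) / 6 - y ^ 2 * (s - y) / 2 + s ^ 2 + (h - s) * s ^ 2 / 2 -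
        y ^ 2 * (s - 1) / 2 + s ^ 2 * y ^ 2 / (2 * h + 1) := by
  have hs0 : (0 : ℝ) < s := by exact_mod_cast hs
  rw [← Finset.sum_range_add_sum_Ico _ hsh]
  have h1 : ∑ t ∈ Finset.range s, min (((t : ℝ) + 1) ^ 2) ((s : ℝ) ^ 2) / 2 *
      max 0 (1 - y ^ 2 / ((t : ℝ) + 1) ^ 2) ≤
      ∑ t ∈ Finset.range s, max 0 ((((t : ℝ) + 1) ^ 2 - y ^ 2) / 2) := by
    refine Finset.sum_le_sum fun t _ => ?_
    have hp : (0 : ℝ) < ((t : ℝ) + 1) ^ 2 := by positivity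
    calc _ ≤ ((t : ℝ) + 1) ^ 2 / 2 * max 0 (1 - y ^ 2 / ((t : ℝ) + 1) ^ 2) :=
          mul_le_mul_of_nonneg_right (by linarith [min_le_left (((t : ℝ) + 1) ^ 2) ((s : ℝ) ^ 2)])
            (le_max_left _ _)
      _ = _ := by
          rw [mul_max_of_nonneg _ _ (by positivity), mul_zero]
          congr 1
          field_simp
  have h2 : ∑ t ∈ Finset.Ico s h, min (((t : ℝ) + 1) ^ 2) ((s : ℝ) ^ 2) / 2 *
      max 0 (1 - y ^ 2 / ((t : ℝ) + 1) ^ 2) ≤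
      ∑ t ∈ Finset.Ico s h, ((s : ℝ) ^ 2 / 2 - s ^ 2 * y ^ 2 / 2 * (1 / ((t : ℝ) + 1) ^ 2)) := by
    refine Finset.sum_le_sum fun t ht => ?_
    have hst : (s : ℝ) ≤ t := by exact_mod_cast (Finset.mem_Ico.mp ht).1
    have hp : (0 : ℝ) < ((t : ℝ) + 1) ^ 2 := by positivity
    have hyt : y ^ 2 ≤ ((t : ℝ) + 1) ^ 2 := pow_le_pow_left₀ hy (by linarith) 2
    have hmax : max 0 (1 - y ^ 2 / ((t : ℝ) + 1) ^ 2) = 1 - y ^ 2 / ((t : ℝ) + 1) ^ 2 :=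
      max_eq_right (sub_nonneg.mpr ((div_le_one hp).mpr hyt))
    rw [hmax]
    calc _ ≤ (s : ℝ) ^ 2 / 2 * (1 - y ^ 2 / ((t : ℝ) + 1) ^ 2) :=
          mul_le_mul_of_nonneg_right (by linarith [min_le_right (((t : ℝ) + 1) ^ 2) ((s : ℝ) ^ 2)])
            (hmax ▸ le_max_left _ _)
      _ = _ := by ring
  rw [Finset.sum_sub_distrib, ← Finset.mul_sum, Finset.sum_const, Nat.card_Ico, nsmul_eq_mul,
    Nat.cast_sub hsh] at h2
  have h3 := sum_sq_sub_sq_le hy s hys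
  have h4 := mul_le_mul_of_nonneg_left (le_sum_inv_sq hsh)
    (show (0 : ℝ) ≤ s ^ 2 * y ^ 2 / 2 by positivity)
  have h5 : y ^ 2 * ((s : ℝ) - 1) / 2 ≤ s ^ 2 * y ^ 2 / 2 * (1 / (s + 1)) := by
    rw [mul_one_div, le_div_iff₀ (by positivity)]
    nlinarith [sq_nonneg y]
  have h6 : (s : ℝ) ^ 2 * y ^ 2 / 2 * (1 / (h + 1)) ≤ s ^ 2 * y ^ 2 / (2 * h + 1) := by
    rw [mul_one_div, div_div]
    exact div_le_div_of_nonneg_left (by positivity) (by positivity) (by linarith)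
  rw [mul_sub] at h4
  linarith

/-- The same sum, when `k < 2 s / 5`, under the constraint that bounds a weighted sum of the
sequence by `k`. -/
theorem sum_le_of_small {f : ℕ → ℝ} {k h s κ : ℕ} {a δ ρ : ℝ} (hδ : 0 ≤ δ) (hρ : 0 ≤ ρ)
    (hs : 0 < s) (hsh : s ≤ h) (hf0 : ∀ e, 0 ≤ f e) (hfa : ∀ e, f e ≤ a)
    (hsa : (s : ℝ) ^ 2 ≤ 2 * a)
    (hf1 : ∀ e < h, f e ≤ ((e : ℝ) + 1) ^ 2 / 2 + δ) (hf2 : ∀ e < h, f e ≤ (s : ℝ) ^ 2 / 2 + δ)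
    (hcon : a / (2 * h + 1) + ∑ e ∈ Finset.Ico κ h, f e * (1 / (2 * ((e : ℝ) + 1) ^ 2)) ≤ k + ρ)
    (hk : (k : ℝ) ≤ 2 / 5 * s) :
    ∑ e ∈ Finset.Ico k h, f e ≤
      h * δ + ((s : ℝ) ^ 3 - (2 / 5 * s) ^ 3) / 6 + (h - s) * s ^ 2 / 2 + 2 * s ^ 2 +
        κ * a + 2 * s ^ 2 * ρ := by
  have hs0 : (0 : ℝ) < s := by exact_mod_cast hs
  set y : ℝ := 2 / 5 * s with hy
  have hy0 : 0 ≤ y := by positivity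
  have hys : y ≤ s := by rw [hy]; linarith
  have h1 : ∑ e ∈ Finset.Ico k h, f e ≤
      ∑ e ∈ Finset.range κ, f e + ∑ e ∈ Finset.Ico κ h, f e := by
    rw [← Finset.sum_union (Finset.disjoint_left.mpr fun e he he' => by
      rw [Finset.mem_range] at he
      rw [Finset.mem_Ico] at he'
      omega)]
    refine Finset.sum_le_sum_of_subset_of_nonneg (fun e he => ?_) fun e _ _ => hf0 e
    rw [Finset.mem_Ico] at he
    rw [Finset.mem_union, Finset.mem_range, Finset.mem_Ico]
    omega
  have h2 : ∑ e ∈ Finset.range κ, f e ≤ κ * a := by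
    refine (Finset.sum_le_sum fun e _ => hfa e).trans_eq ?_
    rw [Finset.sum_const, Finset.card_range, nsmul_eq_mul]
  -- Lagrange multiplier `2y²`: with `r = y²/(e+1)²`, the part `f e * r` is charged to the
  -- constraint, and `f e * (1 - r)` is bounded by the cap.
  have hterm : ∀ e ∈ Finset.Ico κ h, f e ≤ 2 * y ^ 2 * (f e * (1 / (2 * ((e : ℝ) + 1) ^ 2))) +
      (min (((e : ℝ) + 1) ^ 2) ((s : ℝ) ^ 2) / 2 * max 0 (1 - y ^ 2 / ((e : ℝ) + 1) ^ 2) + δ) := by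
    intro e he
    rw [Finset.mem_Ico] at he
    have hp : (0 : ℝ) < ((e : ℝ) + 1) ^ 2 := by positivity
    set r := y ^ 2 / ((e : ℝ) + 1) ^ 2 with hr
    have hr0 : 0 ≤ r := by positivity
    have h3 : 2 * y ^ 2 * (f e * (1 / (2 * ((e : ℝ) + 1) ^ 2))) = f e * r := by
      rw [hr]
      field_simp
    have h4 : f e ≤ min (((e : ℝ) + 1) ^ 2) ((s : ℝ) ^ 2) / 2 + δ := by
      rcases min_cases (((e : ℝ) + 1) ^ 2) ((s : ℝ) ^ 2) with ⟨h, _⟩ | ⟨h, _⟩ <;> rw [h]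
      · exact hf1 e he.2
      · exact hf2 e he.2
    have h5 : max 0 (1 - r) ≤ 1 := max_le zero_le_one (by linarith)
    have h6 : f e * (1 - r) ≤ f e * max 0 (1 - r) :=
      mul_le_mul_of_nonneg_left (le_max_right _ _) (hf0 e)
    have h7 := mul_le_mul_of_nonneg_right h4 (le_max_left 0 (1 - r))
    have h8 : δ * max 0 (1 - r) ≤ δ := mul_le_of_le_one_right hδ h5
    rw [h3]
    linarith
  have h3 := Finset.sum_le_sum hterm
  rw [Finset.sum_add_distrib, ← Finset.mul_sum] at h3
  have h4 : ∑ e ∈ Finset.Ico κ h, (min (((e : ℝ) + 1) ^ 2) ((s : ℝ) ^ 2) / 2 *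
        max 0 (1 - y ^ 2 / ((e : ℝ) + 1) ^ 2) + δ) ≤
      ∑ e ∈ Finset.range h, (min (((e : ℝ) + 1) ^ 2) ((s : ℝ) ^ 2) / 2 *
        max 0 (1 - y ^ 2 / ((e : ℝ) + 1) ^ 2) + δ) := by
    refine Finset.sum_le_sum_of_subset_of_nonneg (fun e he => ?_) fun e _ _ => by positivity
    rw [Finset.mem_Ico] at he
    exact Finset.mem_range.mpr he.2
  rw [Finset.sum_add_distrib (f := fun e : ℕ => min (((e : ℝ) + 1) ^ 2) ((s : ℝ) ^ 2) / 2 *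
        max 0 (1 - y ^ 2 / ((e : ℝ) + 1) ^ 2)) (s := Finset.range h), Finset.sum_const,
    Finset.card_range, nsmul_eq_mul] at h4
  have h5 := sum_weighted_le hs hsh hy0 hys
  have h6 : 2 * y ^ 2 * ∑ e ∈ Finset.Ico κ h, f e * (1 / (2 * ((e : ℝ) + 1) ^ 2)) ≤
      2 * y ^ 2 * (y + ρ - s ^ 2 / 2 / (2 * h + 1)) := by
    refine mul_le_mul_of_nonneg_left ?_ (by positivity)
    have : (s : ℝ) ^ 2 / 2 / (2 * h + 1) ≤ a / (2 * h + 1) :=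
      div_le_div_of_nonneg_right (by linarith) (by positivity)
    linarith
  have h7 : 2 * y ^ 2 * ((s : ℝ) ^ 2 / 2 / (2 * h + 1)) = s ^ 2 * y ^ 2 / (2 * h + 1) := by ring
  have h8 : y ^ 2 * ρ ≤ (s : ℝ) ^ 2 * ρ :=
    mul_le_mul_of_nonneg_right (pow_le_pow_left₀ hy0 hys 2) hρ
  have h9 : y ^ 2 ≤ (s : ℝ) ^ 2 := pow_le_pow_left₀ hy0 hys 2
  -- The terms over `2h + 1` cancel, and the remaining terms in `y` beyond `-y³/6` add up to
  -- `y²(5y/2 - s)`. This vanishes for `y = 2s/5`, whence the threshold.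
  have h10 : y ^ 2 * y - y ^ 2 * (2 / 5 * s) = 0 := by rw [← hy]; ring
  nlinarith

/-- The maximum over `s` is at `s = 125n/258`, a double root of the difference. The coefficient is
`43/125 = 1/2 - (1 - (2/5)³)/6`. -/
theorem cubic_le {n s : ℝ} (hn : 0 ≤ n) (hs : 0 ≤ s) :
    n * s ^ 2 / 4 - 43 / 125 * s ^ 3 ≤ 15625 / 798768 * n ^ 3 := by
  have h : 15625 / 798768 * n ^ 3 - (n * s ^ 2 / 4 - 43 / 125 * s ^ 3) =
      43 / 125 * ((s - 125 / 258 * n) ^ 2 * (s + 125 / 516 * n)) := by ring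
  have : 0 ≤ 43 / 125 * ((s - 125 / 258 * n) ^ 2 * (s + 125 / 516 * n)) := by positivity
  linarith

end Estimates

/-! ### Assembling the cubic bound -/

theorem six_mul_sum_tri (T : ℕ) :
    6 * ∑ e ∈ Finset.range T, (tri e : ℝ) = T * (T + 1) * (T + 2) := by
  induction T with
  | zero => simp
  | succ T ih =>
    have h : 2 * (tri T : ℝ) = (T + 1) * (T + 2) := by exact_mod_cast two_mul_tri T
    rw [Finset.sum_range_succ, mul_add, ih]
    push_cast
    linear_combination 3 * h

/-- The constant is `7/48 = (1 - 1/8)/6`, from `∑ e²/2` between `n/2` and `n`. -/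
theorem sum_tri_le {n h : ℕ} (hn : n ≤ 2 * h) (hh : h ≤ n - 1) :
    ∑ e ∈ Finset.Ico h (n - 1), (tri e : ℝ) ≤ 7 / 48 * (n : ℝ) ^ 3 := by
  have h1 := Finset.sum_range_add_sum_Ico (fun e => (tri e : ℝ)) hh
  have h2 := six_mul_sum_tri h
  have h3 := six_mul_sum_tri (n - 1)
  rcases Nat.eq_zero_or_pos n with rfl | h0
  · simp
  rw [Nat.cast_sub h0, Nat.cast_one] at h3
  have h4 : (n : ℝ) ≤ 2 * h := by exact_mod_cast hn
  have h5 : (n : ℝ) ^ 3 ≤ (2 * h) ^ 3 := pow_le_pow_left₀ (Nat.cast_nonneg n) h4 3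
  have h6 : (0 : ℝ) ≤ h := Nat.cast_nonneg h
  have h7 : (0 : ℝ) ≤ n := Nat.cast_nonneg n
  nlinarith

theorem sum_stepCost_le {ε : ℕ → ℕ} {n a k : ℕ} (hn : 2 ≤ n) (hε : ∀ l, ε l ≤ n)
    (ha : a ≤ (n + 1) * (n + 3) / 8)
    (hk : ∑ i ∈ Finset.range (a - (n + 1)),
      (1 : ℝ) / ((max (ε (i + (n + 1))) (Nat.sqrt n) : ℕ) + 1) ≤ k) :
    ∑ e ∈ Finset.Ico k (n - 1), (stepCost ε n a e : ℝ) ≤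
      (7 / 48 + 2 * 15625 / 1597536) * (n : ℝ) ^ 3 + 10 * ((n : ℝ) ^ 2 * Nat.sqrt n) := by
  -- Shifting the sum by `n + 1` costs up to `s² · n/κ`, and forgetting the indices below `κ` costs
  -- `κ · a`. With `s²` and `a` of order at most `n²`, the choice `√n` balances both at `n² √n`.
  set κ := Nat.sqrt n with hκ
  set h := (n + 1) / 2 with hh
  set s := Nat.sqrt (2 * a) with hs
  have hκ1 : 1 ≤ κ := Nat.le_sqrt.mpr (by omega)
  have hκn : κ ≤ n := Nat.sqrt_le_self n
  have hnκ : n < (κ + 1) * (κ + 1) := Nat.lt_succ_sqrt n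
  have hs1 : s * s ≤ 2 * a := Nat.sqrt_le (2 * a)
  have hs2 : 2 * a ≤ s * s + s + s := Nat.sqrt_le_add (2 * a)
  have ha8 : 8 * a ≤ (n + 1) * (n + 3) := by omega
  -- Otherwise `(n + 2)² ≤ 4s² ≤ 8a ≤ (n + 1)(n + 3)`, which is false.
  have hsn : 2 * s ≤ n + 1 := by
    by_contra! hlt
    nlinarith
  have hsh : s ≤ h := by omega
  set f : ℕ → ℝ := fun e => (min (tri e) (countLE ε a e) : ℕ) with hf
  have hnR : (2 : ℝ) ≤ n := by exact_mod_cast hn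
  have hκR : (1 : ℝ) ≤ κ := by exact_mod_cast hκ1
  have hhR : 2 * (h : ℝ) ≤ n + 1 := by
    have : 2 * h ≤ n + 1 := by omega
    exact_mod_cast this
  have hshR : (s : ℝ) ≤ h := by exact_mod_cast hsh
  have hs0 : (0 : ℝ) ≤ s := Nat.cast_nonneg s
  have hs1R : (s : ℝ) ^ 2 ≤ 2 * a := by rw [sq]; exact_mod_cast hs1
  have hs2R : 2 * (a : ℝ) ≤ s * s + s + s := by exact_mod_cast hs2
  have ha8R : 8 * (a : ℝ) ≤ (n + 1) * (n + 3) := by exact_mod_cast ha8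
  have hf0 : ∀ e, 0 ≤ f e := fun e => Nat.cast_nonneg _
  have hfc : ∀ e, f e ≤ countLE ε a e := fun e => Nat.cast_le.mpr (min_le_right _ _)
  have hfa : ∀ e, f e ≤ a := fun e => (hfc e).trans (by exact_mod_cast countLE_le ε a e)
  have hf1 : ∀ e < h, f e ≤ ((e : ℝ) + 1) ^ 2 / 2 + ((n : ℝ) + 1) := by
    intro e he
    have h1 : f e ≤ tri e := Nat.cast_le.mpr (min_le_left _ _)
    have h2 : 2 * (tri e : ℝ) = (e + 1) * (e + 2) := by exact_mod_cast two_mul_tri e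
    have h3 : (e : ℝ) + 1 ≤ h := by exact_mod_cast he
    nlinarith
  have hf2 : ∀ e < h, f e ≤ (s : ℝ) ^ 2 / 2 + ((n : ℝ) + 1) := by
    intro e _
    have := hfa e
    nlinarith
  have hmain : ∑ e ∈ Finset.Ico k h, f e ≤
      h * ((n : ℝ) + 1) + ((s : ℝ) ^ 3 - (2 / 5 * s) ^ 3) / 6 + (h - s) * s ^ 2 / 2 + 2 * s ^ 2 +
        κ * a + 2 * s ^ 2 * (2 * κ) := by
    rcases le_or_gt (2 / 5 * (s : ℝ)) k with hks | hks
    · have h1 := sum_le_of_large (by positivity) hsh hf1 hf2 hks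
      have h2 : (0 : ℝ) ≤ s ^ 2 + κ * a + 2 * s ^ 2 * (2 * κ) := by positivity
      linarith
    · have hspos : 0 < s := by
        rcases Nat.eq_zero_or_pos s with h0 | h0
        · rw [h0] at hks
          norm_num at hks
          exact absurd hks (not_lt.mpr (Nat.cast_nonneg k))
        · exact h0
      refine sum_le_of_small (a := a) (by positivity) (by positivity) hspos hsh hf0 hfa hs1R
        hf1 hf2 ?_ hks.le
      have h1 := sum_countLE_le (ε := ε) (a := a) (κ := κ) (h := h)
        (fun l => (hε l).trans (by omega)) (by omega)
      have h2 := sum_one_div_le_shift (g := ε) (a := a) (m := n + 1) (κ := κ)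
      have h3 : ((n + 1 : ℕ) : ℝ) / (κ + 1) ≤ 2 * κ := by
        rw [div_le_iff₀ (by positivity)]
        have : ((n + 1 : ℕ) : ℝ) ≤ (κ + 1) * (κ + 1) := by exact_mod_cast hnκ
        nlinarith
      have h4 : ∑ e ∈ Finset.Ico κ h, f e * (1 / (2 * ((e : ℝ) + 1) ^ 2)) ≤
          ∑ e ∈ Finset.Ico κ h, (countLE ε a e : ℝ) * (1 / (2 * ((e : ℝ) + 1) ^ 2)) :=
        Finset.sum_le_sum fun e _ => mul_le_mul_of_nonneg_right (hfc e) (by positivity)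
      linarith
  have hsplit : ∑ e ∈ Finset.Ico k (n - 1), (stepCost ε n a e : ℝ) ≤
      ∑ e ∈ Finset.Ico k h, f e + ∑ e ∈ Finset.Ico h (n - 1), (tri e : ℝ) := by
    have h1 : ∑ e ∈ Finset.Ico k h, f e = ∑ e ∈ Finset.Ico k h, (stepCost ε n a e : ℝ) :=
      Finset.sum_congr rfl fun e he => by
        rw [Finset.mem_Ico] at he
        rw [stepCost, if_pos (by omega)]
    have h2 : ∑ e ∈ Finset.Ico h (n - 1), (tri e : ℝ) =
        ∑ e ∈ Finset.Ico h (n - 1), (stepCost ε n a e : ℝ) :=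
      Finset.sum_congr rfl fun e he => by
        rw [Finset.mem_Ico] at he
        rw [stepCost, if_neg (by omega)]
    rw [h1, h2, ← Finset.sum_union (Finset.Ico_disjoint_Ico_consecutive k h (n - 1))]
    refine Finset.sum_le_sum_of_subset_of_nonneg (fun e he => ?_) fun _ _ _ => Nat.cast_nonneg _
    rw [Finset.mem_union, Finset.mem_Ico, Finset.mem_Ico]
    rw [Finset.mem_Ico] at he
    omega
  have htail := sum_tri_le (n := n) (h := h) (by omega) (by omega)
  have hcubic := cubic_le (n := n) (s := s) (by positivity) hs0
  have hsn' : (s : ℝ) ≤ n := by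
    have : s ≤ n := by omega
    exact_mod_cast this
  have e1 : h * ((n : ℝ) + 1) ≤ 2 * (n : ℝ) ^ 2 := by nlinarith
  have e2 : (s : ℝ) ^ 2 ≤ (n : ℝ) ^ 2 := pow_le_pow_left₀ hs0 hsn' 2
  have e3 : (a : ℝ) ≤ (n : ℝ) ^ 2 := by nlinarith
  have e4 : (κ : ℝ) * a ≤ κ * (n : ℝ) ^ 2 := mul_le_mul_of_nonneg_left e3 (by positivity)
  have e5 : (s : ℝ) ^ 2 * κ ≤ (n : ℝ) ^ 2 * κ := mul_le_mul_of_nonneg_right e2 (by positivity)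
  have e6 : (n : ℝ) ^ 2 ≤ (n : ℝ) ^ 2 * κ := le_mul_of_one_le_right (by positivity) hκR
  have e7 : (h : ℝ) * s ^ 2 ≤ (n + 1) / 2 * s ^ 2 :=
    mul_le_mul_of_nonneg_right (by linarith) (by positivity)
  linarith

namespace CompleteAutomaton

theorem exists_reset_word_of_transitive {α Q : Type*} [Finite Q] [Nonempty Q]
    (A : CompleteAutomaton α Q) (hA : ∀ q, ∃ w, ∀ x, A.act x w = q) :
    ∃ (w : List α) (q : Q), (∀ x, A.act x w = q) ∧
      (w.length : ℝ) ≤ (7 / 48 + 2 * 15625 / 1597536) * (Nat.card Q : ℝ) ^ 3 +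
        11 * ((Nat.card Q : ℝ) ^ 2 * Nat.sqrt (Nat.card Q)) := by
  classical
  have := Fintype.ofFinite Q
  rw [Nat.card_eq_fintype_card]
  rcases lt_or_ge 1 (Fintype.card Q) with hQ | hQ
  · set n := Fintype.card Q with hn
    obtain ⟨ε, a, k, w, q, hw, hab, hε, hk, hlen⟩ :=
      A.exists_reset_word_le_sum hA hQ (κ := Nat.sqrt n) (b := (n + 1) * (n + 3) / 8)
        (Nat.sqrt_le_self n) fun e he => by
          rw [Nat.le_div_iff_mul_le (by norm_num)]
          have := two_mul_tri e
          nlinarith [Nat.succ_le_of_lt he]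
    refine ⟨w, q, hw, ?_⟩
    have h1 := sum_stepCost_le hQ hε hab hk
    have h2 : (w.length : ℝ) ≤
        a + ∑ e ∈ Finset.Ico k (n - 1), (stepCost ε n a e : ℝ) := by exact_mod_cast hlen
    have h3 : (a : ℝ) ≤ (n : ℝ) ^ 2 * Nat.sqrt n := by
      have h4 : 1 ≤ Nat.sqrt n := Nat.le_sqrt.mpr (by omega)
      have h5 : 8 * a ≤ (n + 1) * (n + 3) := by omega
      have h6 : a ≤ n ^ 2 := by nlinarith
      exact_mod_cast h6.trans (Nat.le_mul_of_pos_right _ h4)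
    linarith
  · have := Fintype.card_le_one_iff_subsingleton.mp hQ
    refine ⟨[], Classical.arbitrary Q, fun x => Subsingleton.elim _ _, ?_⟩
    rw [List.length_nil, Nat.cast_zero]
    positivity

theorem IsSynchronizing.resetThreshold_le {α Q : Type*} [Finite Q] {A : CompleteAutomaton α Q}
    (h : A.IsSynchronizing) :
    (A.resetThreshold : ℝ) ≤ (7 / 48 + 2 * 15625 / 1597536) * (Nat.card Q : ℝ) ^ 3 +
      12 * ((Nat.card Q : ℝ) ^ 2 * Nat.sqrt (Nat.card Q)) := by
  have hmono : Monotone fun n : ℕ => (7 / 48 + 2 * 15625 / 1597536 : ℝ) * (n : ℝ) ^ 3 +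
      11 * ((n : ℝ) ^ 2 * Nat.sqrt n) := by
    intro m n hmn
    have hmn' : (m : ℝ) ≤ n := by exact_mod_cast hmn
    have hs : (Nat.sqrt m : ℝ) ≤ Nat.sqrt n := by exact_mod_cast Nat.sqrt_le_sqrt hmn
    dsimp only
    gcongr
  have h1 := h.resetThreshold_le_add hmono fun R B hR hB => by
    have := hR.to_subtype
    exact B.exists_reset_word_of_transitive hB
  have h2 : (Nat.card Q : ℝ) ^ 2 ≤ (Nat.card Q : ℝ) ^ 2 * Nat.sqrt (Nat.card Q) := by
    rcases Nat.eq_zero_or_pos (Nat.card Q) with h0 | h0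
    · simp [h0]
    · refine le_mul_of_one_le_right (by positivity) ?_
      exact_mod_cast Nat.le_sqrt.mpr (by omega)
  linarith

end CompleteAutomaton

/-! ### Asymptotic form and the absolute constant -/

theorem isLittleO_sq_mul_sqrt :
    (fun n : ℕ => 12 * ((n : ℝ) ^ 2 * Nat.sqrt n)) =o[atTop] fun n : ℕ => (n : ℝ) ^ 3 := by
  refine IsLittleO.const_mul_left ?_ 12
  have h : (fun n : ℕ => (Nat.sqrt n : ℝ)) =o[atTop] fun n : ℕ => (n : ℝ) := by
    rw [isLittleO_iff]
    intro c hc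
    obtain ⟨N, hN⟩ := exists_nat_gt (1 / c)
    filter_upwards [eventually_ge_atTop (N * N)] with n hn
    have h1 : (N : ℝ) ≤ Nat.sqrt n := by exact_mod_cast Nat.le_sqrt.mpr hn
    have h2 : (Nat.sqrt n : ℝ) * Nat.sqrt n ≤ n := by exact_mod_cast Nat.sqrt_le n
    have h3 : 1 ≤ c * Nat.sqrt n := by
      have := (div_lt_iff₀' hc).mp (hN.trans_le h1)
      linarith
    rw [Real.norm_of_nonneg (Nat.cast_nonneg _), Real.norm_of_nonneg (Nat.cast_nonneg _)]
    have h4 : (0 : ℝ) ≤ Nat.sqrt n := Nat.cast_nonneg _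
    nlinarith
  exact ((isBigO_refl (fun n : ℕ => (n : ℝ) ^ 2) atTop).mul_isLittleO h).congr_right
    fun n => (pow_succ (n : ℝ) 2).symm

theorem exists_le_mul_add_of_isLittleO {f g : ℕ → ℝ} (hfg : f =o[atTop] g) (hg : ∀ n, 0 ≤ g n)
    {c : ℝ} (hc : 0 < c) : ∃ C, ∀ n, f n ≤ c * g n + C := by
  obtain ⟨N, hN⟩ := eventually_atTop.mp (isLittleO_iff.mp hfg hc)
  refine ⟨∑ i ∈ Finset.range N, |f i|, fun n => ?_⟩
  have hcg : 0 ≤ c * g n := mul_nonneg hc.le (hg n)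
  rcases le_or_gt N n with hn | hn
  · have h1 := hN n hn
    rw [Real.norm_of_nonneg (hg n)] at h1
    have h2 : 0 ≤ ∑ i ∈ Finset.range N, |f i| := Finset.sum_nonneg fun i _ => abs_nonneg _
    linarith [le_abs_self (f n), Real.norm_eq_abs (f n)]
  · have := Finset.single_le_sum (f := fun i => |f i|) (fun i _ => abs_nonneg _)
      (Finset.mem_range.mpr hn)
    linarith [le_abs_self (f n)]

theorem mainTheorem1 :
    (∃ f : ℕ → ℝ, f =o[atTop] (fun n : ℕ => (n : ℝ) ^ 3) ∧
      ∀ (α : Type u) (Q : Type v) [Finite α] [Finite Q] (A : CompleteAutomaton α Q),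
        A.IsSynchronizing →
          (A.resetThreshold : ℝ) ≤
            (7 / 48 + 2 * 15625 / 1597536 : ℝ) * (Nat.card Q : ℝ) ^ 3 + f (Nat.card Q)) ∧
    (∃ C : ℝ,
      ∀ (α : Type u) (Q : Type v) [Finite α] [Finite Q] (A : CompleteAutomaton α Q),
        A.IsSynchronizing →
          (A.resetThreshold : ℝ) ≤ (0.1654 : ℝ) * (Nat.card Q : ℝ) ^ 3 + C) := by
  refine ⟨⟨_, isLittleO_sq_mul_sqrt, fun α Q _ _ A hA => hA.resetThreshold_le⟩, ?_⟩
  -- The leading constant is about `0.165395`, so `0.1654` leaves a small positive multiple of `n³`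
  -- that absorbs the error term up to a constant.
  obtain ⟨C, hC⟩ := exists_le_mul_add_of_isLittleO isLittleO_sq_mul_sqrt
    (fun n => by positivity) (c := 0.1654 - (7 / 48 + 2 * 15625 / 1597536)) (by norm_num)
  refine ⟨C, fun α Q _ _ A hA => ?_⟩
  linarith [hA.resetThreshold_le, hC (Nat.card Q)]
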